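/- A stick knot is a simple closed polygon in $\mathbb{R}^3$, and its number of sticks is its number of edges. Two stick knots are equivalent if they are related by a finite sequence of triangle moves and inverse triangle moves (equivalently, by a p.l. isotopy of $\mathbb{R}^3$); a triangle move replaces a segment $AB\subset K$ by $AC\cup CB$, where $ABC$ is a nondegenerate triangle with $ABC\cap K=AB$. The stick number $s[K]$ of a knot class $[K]$ is the minimum number of sticks of a stick knot in $[K]$. A stick rail arc is a simple polygonal arc $r\subset\mathbb{R}^3$ together with two distinct parallel lines $\ell_1,\ell_2$ (the rails) with a chosen upward direction, such that $r$ has one endpoint (the tail) on $\ell_1$ and the other (the head) on $\ell_2$, and the interior of $r$ is disjoint from $\ell_1\cup\ell_2$. The under (respectively over) companion of $r$ is the knot class obtained by closing $r$ as follows: run from the tail along $\ell_1$ to a point lying below (respectively above) all of $r$, cross to $\ell_2$ along a segment perpendicular to the rails, and run along $\ell_2$ to the head. The rail stick number $rs[K]$ of a knot class $[K]$ is the minimum number of sticks of a stick rail arc whose under or over companion is $[K]$. Theorem. For every knot class $[K]$, $$s[K]-2\;\leq\; rs[K]\;\leq\; s[K]-1 .$$ -/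

import Mathlib

/-- Three-dimensional Euclidean space. -/
abbrev Space3 : Type := EuclideanSpace ℝ (Fin 3)

/-- The polygonal curve made of the `n` sticks `[v i, v (i + 1)]`, `i < n`. Only the values of `v`
at `0, …, n` are used. -/
def polyline (n : ℕ) (v : ℕ → Space3) : Set Space3 :=
  {x | ∃ i < n, x ∈ segment ℝ (v i) (v (i + 1))}

/-- A stick knot: a simple closed polygon in space, given by its successive vertices
`v 0, v 1, …, v n = v 0`. -/
structure StickKnot where
  /-- the number of sticks -/
  numSticks : ℕ
  /-- the successive vertices; only the values at `0, …, numSticks` matter -/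
  vertex : ℕ → Space3
  three_le : 3 ≤ numSticks
  closed : vertex numSticks = vertex 0
  nondegenerate : ∀ i < numSticks, vertex i ≠ vertex (i + 1)
  /-- two different sticks meet at most in a common end point of cyclically consecutive sticks -/
  simple : ∀ i j : ℕ, i < j → j < numSticks → ∀ x : Space3,
    x ∈ segment ℝ (vertex i) (vertex (i + 1)) → x ∈ segment ℝ (vertex j) (vertex (j + 1)) →
      (j = i + 1 ∧ x = vertex j) ∨ (i = 0 ∧ j + 1 = numSticks ∧ x = vertex 0)

/-- The point set of a stick knot. -/
def StickKnot.carrier (K : StickKnot) : Set Space3 := polyline K.numSticks K.vertex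

/-- A triangle move: if a nondegenerate (closed, solid) triangle `ABC` meets `K` exactly in its side
`AB`, then this side is replaced by the two other sides `AC` and `CB`. The side `AB` need not be a
whole stick. Applied forwards or backwards to a simple closed polygon, a triangle move yields a
simple closed polygon again. -/
def TriangleMove (K K' : Set Space3) : Prop :=
  ∃ A B C : Space3, AffineIndependent ℝ ![A, B, C] ∧
    convexHull ℝ {A, B, C} ∩ K = segment ℝ A B ∧
    K' = (K \ segment ℝ A B) ∪ segment ℝ A C ∪ segment ℝ C B

/-- Equivalence of polygonal knots: a finite sequence of triangle moves and inverse triangle moves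
leads from one to the other. -/
def PLEquiv : Set Space3 → Set Space3 → Prop := Relation.EqvGen TriangleMove

/-- Two stick knots are equivalent if their point sets are. -/
instance stickKnotSetoid : Setoid StickKnot where
  r K L := PLEquiv K.carrier L.carrier
  iseqv :=
    { refl := fun K => Relation.EqvGen.refl K.carrier
      symm := fun h => Relation.EqvGen.symm _ _ h
      trans := fun h h' => Relation.EqvGen.trans _ _ _ h h' }

/-- Knot classes. -/
def KnotClass : Type := Quotient stickKnotSetoid

/-- The knot class `[K]` of a stick knot `K`. -/
def StickKnot.knotClass (K : StickKnot) : KnotClass := Quotient.mk stickKnotSetoid K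

/-- The stick number: the least number of sticks of a representative. -/
noncomputable def stickNumber (κ : KnotClass) : ℕ :=
  sInf {n | ∃ K : StickKnot, K.knotClass = κ ∧ K.numSticks = n}

/-- Two distinct parallel lines `p + ℝ d` and `q + ℝ d` in space, with `d` pointing upwards. The base
points are chosen at the same height, so that `p + t d` and `q + t d` are always joined by a segment
perpendicular to the rails. -/
structure Rails where
  p : Space3
  q : Space3
  d : Space3
  d_ne_zero : d ≠ 0
  p_ne_q : p ≠ q
  perp : inner ℝ (q - p) d = 0

/-- The point with parameter `t` on the first rail. -/
noncomputable def Rails.point₁ (R : Rails) (t : ℝ) : Space3 := R.p + t • R.d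

/-- The point with parameter `t` on the second rail. -/
noncomputable def Rails.point₂ (R : Rails) (t : ℝ) : Space3 := R.q + t • R.d

/-- The first rail. -/
def Rails.line₁ (R : Rails) : Set Space3 := Set.range R.point₁

/-- The second rail. -/
def Rails.line₂ (R : Rails) : Set Space3 := Set.range R.point₂

/-- The height of a point of space, measured (up to a positive factor) along the rails. -/
noncomputable def Rails.height (R : Rails) (x : Space3) : ℝ := inner ℝ x R.d

/-- A stick rail arc: a pair of rails together with a simple polygonal arc that starts on the first
rail (tail), ends on the second rail (head), and has its interior disjoint from both rails. -/
structure StickRailArc where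
  rails : Rails
  /-- the number of sticks -/
  numSticks : ℕ
  /-- the successive vertices; only the values at `0, …, numSticks` matter -/
  vertex : ℕ → Space3
  nondegenerate : ∀ i < numSticks, vertex i ≠ vertex (i + 1)
  /-- two different sticks meet at most in a common end point of consecutive sticks -/
  simple : ∀ i j : ℕ, i < j → j < numSticks → ∀ x : Space3,
    x ∈ segment ℝ (vertex i) (vertex (i + 1)) → x ∈ segment ℝ (vertex j) (vertex (j + 1)) →
      j = i + 1 ∧ x = vertex j
  tail_mem : vertex 0 ∈ rails.line₁
  head_mem : vertex numSticks ∈ rails.line₂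
  interior_disjoint : ∀ x ∈ polyline numSticks vertex, x ∈ rails.line₁ ∪ rails.line₂ →
    x = vertex 0 ∨ x = vertex numSticks

/-- The point set of a stick rail arc. -/
def StickRailArc.carrier (r : StickRailArc) : Set Space3 := polyline r.numSticks r.vertex

/-- The arc closed up by running along the first rail from the tail to parameter `t`, then along the
segment perpendicular to the rails to the second rail, and along the second rail to the head. -/
noncomputable def StickRailArc.closure (r : StickRailArc) (t : ℝ) : Set Space3 :=
  r.carrier ∪ segment ℝ (r.vertex 0) (r.rails.point₁ t) ∪
    segment ℝ (r.rails.point₁ t) (r.rails.point₂ t) ∪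
    segment ℝ (r.rails.point₂ t) (r.vertex r.numSticks)

/-- `κ` is the under companion of `r`: the class of `r` closed up along the rails, the connecting
perpendicular segment lying below the whole arc. -/
def StickRailArc.IsUnderCompanion (r : StickRailArc) (κ : KnotClass) : Prop :=
  ∃ K : StickKnot, K.knotClass = κ ∧ ∃ t : ℝ,
    (∀ x ∈ r.carrier, r.rails.height (r.rails.point₁ t) < r.rails.height x) ∧
      PLEquiv K.carrier (r.closure t)

/-- `κ` is the over companion of `r`: the class of `r` closed up along the rails, the connecting
perpendicular segment lying above the whole arc. -/
def StickRailArc.IsOverCompanion (r : StickRailArc) (κ : KnotClass) : Prop :=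
  ∃ K : StickKnot, K.knotClass = κ ∧ ∃ t : ℝ,
    (∀ x ∈ r.carrier, r.rails.height x < r.rails.height (r.rails.point₁ t)) ∧
      PLEquiv K.carrier (r.closure t)

/-- The rail stick number: the least number of sticks of a stick rail arc whose under or over
companion is the given knot class. -/
noncomputable def railStickNumber (κ : KnotClass) : ℕ :=
  sInf {n | ∃ r : StickRailArc, (r.IsUnderCompanion κ ∨ r.IsOverCompanion κ) ∧ r.numSticks = n}

/-! Both bounds come from triangle moves inside the plane of the rails. Lower bound: closing an arc
of `n` sticks along the rails costs three further sticks, but two suffice. Run down the first rail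
very far and return to the head along one slanted stick. Below the head, the arc stays out of a thin
sector along the second rail (`exists_slope_bound`), so a sufficiently steep stick misses the arc.
Two moves relate this knot to the closure (`triangleMove_closure`, `triangleMove_of_sector`). Over
companions become under companions when the rails are reversed. Upper bound: remove the last stick
of a minimal knot and put rails through its ends. If the rails are almost parallel to the removed
stick, the strip between them is very thin; in a generic plane through the stick it then misses the
rest of the knot except at the stick's ends (`eventually_strip_inter_segment`, `exists_rails`).
Hence the stick can be pushed down inside the strip to become the closing path. -/

open scoped InnerProductSpace

/-! ### Triangles, triangle moves and compactness -/

theorem exists_eq_of_mem_convexHull_triple {A B C x : Space3}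
    (hx : x ∈ convexHull ℝ ({A, B, C} : Set Space3)) :
    ∃ a b c : ℝ, 0 ≤ a ∧ 0 ≤ b ∧ 0 ≤ c ∧ a + b + c = 1 ∧ x = a • A + b • B + c • C := by
  rw [convexHull_insert (by simp), mem_convexJoin] at hx
  obtain ⟨y, rfl, z, hz, hx⟩ := hx
  rw [convexHull_pair] at hz
  obtain ⟨b, c, hb, hc, hbc, rfl⟩ := hz
  obtain ⟨a, d, ha, hd, had, rfl⟩ := hx
  refine ⟨a, d * b, d * c, ha, by positivity, by positivity, ?_, by module⟩
  rw [add_assoc, ← mul_add, hbc, mul_one, had]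

theorem affineIndependent_triple {A B C : Space3}
    (h : ∀ s t : ℝ, s • (B - A) + t • (C - A) = 0 → s = 0 ∧ t = 0) :
    AffineIndependent ℝ ![A, B, C] := by
  rw [affineIndependent_iff_of_fintype]
  intro w hw hsum
  rw [Finset.weightedVSub_eq_weightedVSubOfPoint_of_sum_eq_zero _ w _ hw A] at hsum
  simp only [Finset.weightedVSubOfPoint_apply, Fin.sum_univ_three, vsub_eq_sub,
    Matrix.cons_val_zero, Matrix.cons_val_one, Matrix.cons_val, sub_self, smul_zero,
    zero_add] at hsum hw
  obtain ⟨h1, h2⟩ := h _ _ hsum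
  intro i
  fin_cases i
  · simpa [h1, h2] using hw
  · exact h1
  · exact h2

/-- A triangle whose third vertex is pushed across a side which is glued to `Γ` at its ends. -/
theorem triangleMove_union {Γ : Set Space3} {A B C : Space3}
    (hind : AffineIndependent ℝ ![A, B, C])
    (h : ∀ x ∈ convexHull ℝ ({A, B, C} : Set Space3), x ∈ Γ → x = A ∨ x = B) :
    TriangleMove (Γ ∪ segment ℝ A B) (Γ ∪ segment ℝ A C ∪ segment ℝ C B) := by
  have hseg : segment ℝ A B ⊆ convexHull ℝ ({A, B, C} : Set Space3) := by
    rw [← convexHull_pair]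
    exact convexHull_mono (by intro; simp; tauto)
  refine ⟨A, B, C, hind, ?_, ?_⟩
  · ext x
    constructor
    · rintro ⟨hx, hx' | hx'⟩
      · rcases h x hx hx' with rfl | rfl
        · exact left_mem_segment ..
        · exact right_mem_segment ..
      · exact hx'
    · exact fun hx => ⟨hseg hx, Or.inr hx⟩
  · ext x
    simp only [Set.mem_union, Set.mem_sdiff]
    have hA := left_mem_segment ℝ A C
    have hB := right_mem_segment ℝ C B
    by_cases hx : x ∈ segment ℝ A B
    -- Removing `AB` takes from `Γ` at most the points `A` and `B`, and the two new sides put them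
    -- back.
    · have := h x (hseg hx)
      constructor
      · rintro ((h1 | h1) | h1)
        · rcases this h1 with rfl | rfl
          · exact Or.inl (Or.inr hA)
          · exact Or.inr hB
        · tauto
        · tauto
      · tauto
    · tauto

theorem isCompact_segment (a b : Space3) : IsCompact (segment ℝ a b) := by
  rw [← convexHull_pair (𝕜 := ℝ)]
  exact (Set.toFinite _).isCompact_convexHull (𝕜 := ℝ)

theorem isCompact_polyline (n : ℕ) (v : ℕ → Space3) : IsCompact (polyline n v) := by
  have : polyline n v = ⋃ i ∈ Finset.range n, segment ℝ (v i) (v (i + 1)) := by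
    ext x; simp [polyline]
  rw [this]
  exact (Finset.range n).isCompact_biUnion fun i _ => isCompact_segment _ _

/-! ### Coordinates in the plane of the rails: the first rail is `s = 1`, the second `s = 0` -/

namespace Rails

variable (R : Rails)

/-- The point of the plane of the rails with coordinate `s` across and `t` along the rails. -/
noncomputable def planePoint (s t : ℝ) : Space3 := R.q + s • (R.p - R.q) + t • R.d

/-- The coordinate across the rails. -/
noncomputable def cross (x : Space3) : ℝ :=
  ⟪x - R.q, R.p - R.q⟫_ℝ / ⟪R.p - R.q, R.p - R.q⟫_ℝ

/-- The coordinate along the rails. -/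
noncomputable def along (x : Space3) : ℝ := ⟪x - R.q, R.d⟫_ℝ / ⟪R.d, R.d⟫_ℝ

theorem inner_cross_pos : 0 < ⟪R.p - R.q, R.p - R.q⟫_ℝ :=
  real_inner_self_pos.2 (sub_ne_zero.2 R.p_ne_q)

theorem inner_d_pos : 0 < ⟪R.d, R.d⟫_ℝ := real_inner_self_pos.2 R.d_ne_zero

theorem inner_cross_d : ⟪R.p - R.q, R.d⟫_ℝ = 0 := by
  rw [← neg_sub, inner_neg_left, R.perp, neg_zero]

theorem inner_d_cross : ⟪R.d, R.p - R.q⟫_ℝ = 0 := by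
  rw [real_inner_comm, R.inner_cross_d]

@[simp] theorem cross_planePoint (s t : ℝ) : R.cross (R.planePoint s t) = s := by
  have := R.inner_cross_pos.ne'
  rw [cross, planePoint, add_assoc, add_sub_cancel_left, inner_add_left, inner_smul_left,
    inner_smul_left, R.inner_d_cross]
  simp only [conj_trivial, mul_zero, add_zero]
  field_simp

@[simp] theorem along_planePoint (s t : ℝ) : R.along (R.planePoint s t) = t := by
  have := R.inner_d_pos.ne'
  rw [along, planePoint, add_assoc, add_sub_cancel_left, inner_add_left, inner_smul_left,
    inner_smul_left, R.inner_cross_d]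
  simp only [conj_trivial, mul_zero, zero_add]
  field_simp

theorem continuous_cross : Continuous R.cross := by
  unfold cross; fun_prop

theorem continuous_along : Continuous R.along := by
  unfold along; fun_prop

theorem height_eq (x : Space3) : R.height x = R.height R.q + R.along x * ⟪R.d, R.d⟫_ℝ := by
  have := R.inner_d_pos.ne'
  rw [along, height, height, inner_sub_left]
  field_simp
  ring

theorem height_lt_iff (x y : Space3) : R.height x < R.height y ↔ R.along x < R.along y := by
  rw [R.height_eq x, R.height_eq y, add_lt_add_iff_left, mul_lt_mul_iff_left₀ R.inner_d_pos]

theorem point₁_eq (t : ℝ) : R.point₁ t = R.planePoint 1 t := by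
  rw [point₁, planePoint]; module

theorem point₂_eq (t : ℝ) : R.point₂ t = R.planePoint 0 t := by
  rw [point₂, planePoint]; module

theorem planePoint_eq_iff {s t s' t' : ℝ} :
    R.planePoint s t = R.planePoint s' t' ↔ s = s' ∧ t = t' := by
  refine ⟨fun h => ⟨?_, ?_⟩, by rintro ⟨rfl, rfl⟩; rfl⟩
  · simpa using congrArg R.cross h
  · simpa using congrArg R.along h

theorem planePoint_combo {a b : ℝ} (h : a + b = 1) (s t s' t' : ℝ) :
    a • R.planePoint s t + b • R.planePoint s' t' =
      R.planePoint (a * s + b * s') (a * t + b * t') := by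
  obtain rfl : a = 1 - b := by linarith
  simp only [planePoint]; module

theorem planePoint_combo₃ {a b c : ℝ} (h : a + b + c = 1) (s t s' t' s'' t'' : ℝ) :
    a • R.planePoint s t + b • R.planePoint s' t' + c • R.planePoint s'' t'' =
      R.planePoint (a * s + b * s' + c * s'') (a * t + b * t' + c * t'') := by
  obtain rfl : a = 1 - b - c := by linarith
  simp only [planePoint]; module

theorem cross_combo {a b : ℝ} (h : a + b = 1) (x y : Space3) :
    R.cross (a • x + b • y) = a * R.cross x + b * R.cross y := by
  have : a • x + b • y - R.q = a • (x - R.q) + b • (y - R.q) := by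
    obtain rfl : a = 1 - b := by linarith
    module
  simp only [cross, this, inner_add_left, inner_smul_left, conj_trivial]
  ring

theorem along_combo {a b : ℝ} (h : a + b = 1) (x y : Space3) :
    R.along (a • x + b • y) = a * R.along x + b * R.along y := by
  have : a • x + b • y - R.q = a • (x - R.q) + b • (y - R.q) := by
    obtain rfl : a = 1 - b := by linarith
    module
  simp only [along, this, inner_add_left, inner_smul_left, conj_trivial]
  ring

theorem affineIndependent_planePoint {s₁ t₁ s₂ t₂ s₃ t₃ : ℝ}
    (h : (s₂ - s₁) * (t₃ - t₁) - (s₃ - s₁) * (t₂ - t₁) ≠ 0) :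
    AffineIndependent ℝ ![R.planePoint s₁ t₁, R.planePoint s₂ t₂, R.planePoint s₃ t₃] := by
  apply affineIndependent_triple
  intro a b hab
  have key : R.planePoint (a * (s₂ - s₁) + b * (s₃ - s₁)) (a * (t₂ - t₁) + b * (t₃ - t₁)) =
      R.planePoint 0 0 := by
    have : R.planePoint (a * (s₂ - s₁) + b * (s₃ - s₁)) (a * (t₂ - t₁) + b * (t₃ - t₁)) =
      R.planePoint 0 0 + (a • (R.planePoint s₂ t₂ - R.planePoint s₁ t₁) +
        b • (R.planePoint s₃ t₃ - R.planePoint s₁ t₁)) := by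
      simp only [planePoint]; module
    rw [this, hab, add_zero]
  obtain ⟨h1, h2⟩ := R.planePoint_eq_iff.1 key
  constructor
  -- Cramer's rule: eliminating one coefficient leaves the other times the determinant.
  · refine (mul_eq_zero.1 ?_).resolve_right h
    linear_combination (t₃ - t₁) * h1 - (s₃ - s₁) * h2
  · refine (mul_eq_zero.1 ?_).resolve_right h
    linear_combination -(t₂ - t₁) * h1 + (s₂ - s₁) * h2

theorem mem_segment_planePoint {s t s' t' : ℝ} {x : Space3}
    (hx : x ∈ segment ℝ (R.planePoint s t) (R.planePoint s' t')) :
    ∃ a b : ℝ, 0 ≤ a ∧ 0 ≤ b ∧ a + b = 1 ∧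
      x = R.planePoint (a * s + b * s') (a * t + b * t') := by
  obtain ⟨a, b, ha, hb, hab, rfl⟩ := hx
  exact ⟨a, b, ha, hb, hab, R.planePoint_combo hab ..⟩

theorem mem_triangle_planePoint {s t s' t' s'' t'' : ℝ} {x : Space3}
    (hx : x ∈ convexHull ℝ
      ({R.planePoint s t, R.planePoint s' t', R.planePoint s'' t''} : Set Space3)) :
    ∃ a b c : ℝ, 0 ≤ a ∧ 0 ≤ b ∧ 0 ≤ c ∧ a + b + c = 1 ∧
      x = R.planePoint (a * s + b * s' + c * s'') (a * t + b * t' + c * t'') := by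
  obtain ⟨a, b, c, ha, hb, hc, habc, rfl⟩ := exists_eq_of_mem_convexHull_triple hx
  exact ⟨a, b, c, ha, hb, hc, habc, R.planePoint_combo₃ habc ..⟩

/-- Two vertical segments on the same line, one on top of the other. -/
theorem segment_union_planePoint (s : ℝ) {a t t' : ℝ} (h : t' ≤ t) (h' : t ≤ a) :
    segment ℝ (R.planePoint s a) (R.planePoint s t) ∪
        segment ℝ (R.planePoint s t) (R.planePoint s t') =
      segment ℝ (R.planePoint s a) (R.planePoint s t') := by
  have key : ∀ u v : ℝ, segment ℝ (R.planePoint s u) (R.planePoint s v) =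
      (fun r => R.planePoint s r) '' segment ℝ u v := by
    intro u v
    ext x
    constructor
    · rintro ⟨a, b, ha, hb, hab, rfl⟩
      refine ⟨a • u + b • v, ⟨a, b, ha, hb, hab, rfl⟩, ?_⟩
      simp only [R.planePoint_combo hab, smul_eq_mul, ← add_mul, hab, one_mul]
    · rintro ⟨_, ⟨a, b, ha, hb, hab, rfl⟩, rfl⟩
      refine ⟨a, b, ha, hb, hab, ?_⟩
      simp only [R.planePoint_combo hab, smul_eq_mul, ← add_mul, hab, one_mul]
  simp only [key, ← Set.image_union]
  rw [segment_symm ℝ a t, segment_symm ℝ t t', segment_symm ℝ a t', segment_eq_Icc h,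
    segment_eq_Icc h', segment_eq_Icc (h.trans h'), Set.union_comm, Set.Icc_union_Icc_eq_Icc h h']

end Rails

/-! ### Lower bound: closing an arc with two sticks -/

namespace StickRailArc

variable (r : StickRailArc)

theorem exists_vertex_zero_eq : ∃ α, r.vertex 0 = r.rails.planePoint 1 α := by
  obtain ⟨α, h⟩ := r.tail_mem
  exact ⟨α, by rw [← h, Rails.point₁_eq]⟩

theorem exists_vertex_last_eq : ∃ β, r.vertex r.numSticks = r.rails.planePoint 0 β := by
  obtain ⟨β, h⟩ := r.head_mem
  exact ⟨β, by rw [← h, Rails.point₂_eq]⟩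

theorem vertex_zero_ne_last : r.vertex 0 ≠ r.vertex r.numSticks := by
  obtain ⟨α, hα⟩ := r.exists_vertex_zero_eq
  obtain ⟨β, hβ⟩ := r.exists_vertex_last_eq
  rw [hα, hβ, Ne, Rails.planePoint_eq_iff]
  simp

theorem numSticks_pos : 0 < r.numSticks := by
  rcases Nat.eq_zero_or_pos r.numSticks with h | h
  · exact absurd (by rw [h]) r.vertex_zero_ne_last
  · exact h

theorem eq_zero_of_vertex_zero_mem {i : ℕ} (hi : i < r.numSticks)
    (h : r.vertex 0 ∈ segment ℝ (r.vertex i) (r.vertex (i + 1))) : i = 0 := by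
  by_contra h0
  obtain ⟨rfl, h1⟩ := r.simple 0 i (Nat.pos_of_ne_zero h0) hi _ (left_mem_segment ..) h
  exact r.nondegenerate 0 r.numSticks_pos h1

theorem eq_of_vertex_last_mem {i : ℕ} (hi : i < r.numSticks)
    (h : r.vertex r.numSticks ∈ segment ℝ (r.vertex i) (r.vertex (i + 1))) :
    i + 1 = r.numSticks := by
  by_contra h0
  have hn := r.numSticks_pos
  have hs : r.numSticks - 1 + 1 = r.numSticks := by omega
  have h1 := (r.simple i (r.numSticks - 1) (by omega) (by omega) (r.vertex r.numSticks) h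
    (by rw [hs]; exact right_mem_segment ..)).2
  exact r.nondegenerate (r.numSticks - 1) (by omega) (by rw [hs]; exact h1.symm)

theorem vertex_zero_mem_carrier : r.vertex 0 ∈ r.carrier :=
  ⟨0, r.numSticks_pos, left_mem_segment ..⟩

theorem vertex_last_mem_carrier : r.vertex r.numSticks ∈ r.carrier := by
  have hn := r.numSticks_pos
  refine ⟨r.numSticks - 1, by omega, ?_⟩
  rw [Nat.sub_add_cancel hn]
  exact right_mem_segment ..

theorem eq_vertex_zero_of_mem {t : ℝ} (h : r.rails.planePoint 1 t ∈ r.carrier) :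
    r.rails.planePoint 1 t = r.vertex 0 := by
  rcases r.interior_disjoint _ h (Or.inl ⟨t, r.rails.point₁_eq t⟩) with h | h
  · exact h
  · obtain ⟨β, hβ⟩ := r.exists_vertex_last_eq
    rw [hβ, Rails.planePoint_eq_iff] at h
    exact absurd h.1 one_ne_zero

theorem eq_vertex_last_of_mem {t : ℝ} (h : r.rails.planePoint 0 t ∈ r.carrier) :
    r.rails.planePoint 0 t = r.vertex r.numSticks := by
  rcases r.interior_disjoint _ h (Or.inr ⟨t, r.rails.point₂_eq t⟩) with h | h
  · obtain ⟨β, hβ⟩ := r.exists_vertex_zero_eq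
    rw [hβ, Rails.planePoint_eq_iff] at h
    exact absurd h.1 zero_ne_one
  · exact h

/-- Near the head, the part of the arc in the plane of the rails stays out of a thin sector below
the head. -/
theorem exists_slope_bound {β : ℝ} (hβ : r.vertex r.numSticks = r.rails.planePoint 0 β) :
    ∃ M : ℝ, ∀ s τ : ℝ, 0 < s → r.rails.planePoint s τ ∈ r.carrier → β - τ ≤ M * s := by
  set R := r.rails with hR
  have hn := r.numSticks_pos
  have hs : r.numSticks - 1 + 1 = r.numSticks := by omega
  -- all sticks but the last
  obtain ⟨M₁, h₁⟩ : ∃ M : ℝ, ∀ s τ : ℝ, 0 < s →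
      R.planePoint s τ ∈ polyline (r.numSticks - 1) r.vertex → β - τ ≤ M * s := by
    have hcl : IsClosed {x : Space3 | x = R.planePoint (R.cross x) (R.along x) ∧
        0 ≤ R.cross x} := by
      have h1 := R.continuous_cross
      have h2 := R.continuous_along
      refine (isClosed_eq continuous_id ?_).inter (isClosed_le continuous_const h1)
      unfold Rails.planePoint
      fun_prop
    have hcomp := (isCompact_polyline (r.numSticks - 1) r.vertex).inter_right hcl
    -- The arc meets the second rail only in its head, which lies on no stick but the last. So the
    -- slope function below is continuous on a compact set.
    have hne : ∀ x ∈ polyline (r.numSticks - 1) r.vertex ∩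
        {x : Space3 | x = R.planePoint (R.cross x) (R.along x) ∧ 0 ≤ R.cross x},
        R.cross x ≠ 0 := by
      rintro x ⟨⟨i, hi, hxi⟩, hx, -⟩ h0
      rw [h0] at hx
      have hxv : x = r.vertex r.numSticks := by
        rw [hx]
        exact r.eq_vertex_last_of_mem (hx ▸ ⟨i, by omega, hxi⟩)
      have := r.eq_of_vertex_last_mem (i := i) (by omega) (hxv ▸ hxi)
      omega
    have hcont : ContinuousOn (fun x => (β - R.along x) / R.cross x)
        (polyline (r.numSticks - 1) r.vertex ∩
        {x : Space3 | x = R.planePoint (R.cross x) (R.along x) ∧ 0 ≤ R.cross x}) :=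
      (continuous_const.sub R.continuous_along).continuousOn.div
        R.continuous_cross.continuousOn hne
    obtain ⟨M, hM⟩ := (hcomp.image_of_continuousOn hcont).bddAbove
    refine ⟨M, fun s τ hspos hx => ?_⟩
    have := hM ⟨_, ⟨hx, by simp [hspos.le]⟩, rfl⟩
    simp only [Rails.along_planePoint, Rails.cross_planePoint] at this
    rwa [div_le_iff₀ hspos] at this
  -- the last stick
  set w := r.vertex (r.numSticks - 1) with hw
  -- If `R.cross w ≤ 0`, no point of the last stick has `s > 0`, so the value of the quotient (0 by
  -- default when the denominator vanishes) is harmless.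
  refine ⟨max M₁ ((β - R.along w) / R.cross w), fun s τ hspos hx => ?_⟩
  obtain ⟨i, hi, hxi⟩ := hx
  rcases Nat.lt_or_ge i (r.numSticks - 1) with h | h
  · exact (h₁ s τ hspos ⟨i, h, hxi⟩).trans (by gcongr; exact le_max_left _ _)
  · obtain rfl : i = r.numSticks - 1 := by omega
    rw [hs, ← hw, hβ] at hxi
    obtain ⟨a, b, ha, hb, hab, h⟩ := hxi
    have hc : a * R.cross w = s := by
      simpa [R.cross_combo hab] using congrArg R.cross h
    have hd : a * R.along w + b * β = τ := by
      simpa [R.along_combo hab] using congrArg R.along h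
    have hcw : 0 < R.cross w := by
      by_contra hneg
      nlinarith
    -- The last stick emanates from the head, so the slope seen from the head is constant along it.
    refine le_trans (le_of_eq ?_) (mul_le_mul_of_nonneg_right (le_max_right _ _) hspos.le)
    rw [← hc, ← hd]
    field_simp
    linear_combination -β * hab

theorem along_lt_of_below {t : ℝ}
    (h : ∀ x ∈ r.carrier, r.rails.height (r.rails.point₁ t) < r.rails.height x)
    {x : Space3} (hx : x ∈ r.carrier) : t < r.rails.along x := by
  have := h x hx
  rwa [Rails.height_lt_iff, Rails.point₁_eq, Rails.along_planePoint] at this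

/-- Pushing the segment from the first rail to the head across a triangle in the plane of the
rails. -/
theorem triangleMove_of_sector {α β t t' : ℝ} (hα : r.vertex 0 = r.rails.planePoint 1 α)
    (hβ : r.vertex r.numSticks = r.rails.planePoint 0 β) (ht : t < β)
    (h : ∀ a b c : ℝ, 0 < a → 0 ≤ b → 0 ≤ c → a + b + c = 1 →
      r.rails.planePoint a (a * t' + b * β + c * t) ∉ r.carrier) :
    TriangleMove
      (r.carrier ∪ segment ℝ (r.vertex 0) (r.rails.point₁ t') ∪
        segment ℝ (r.rails.point₁ t') (r.vertex r.numSticks))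
      (r.carrier ∪ segment ℝ (r.vertex 0) (r.rails.point₁ t') ∪
        segment ℝ (r.rails.point₁ t') (r.rails.point₂ t) ∪
        segment ℝ (r.rails.point₂ t) (r.vertex r.numSticks)) := by
  rw [hα, hβ, r.rails.point₁_eq, r.rails.point₂_eq]
  apply triangleMove_union
  · apply Rails.affineIndependent_planePoint
    linarith
  · intro x hx hx'
    obtain ⟨a, b, c, ha, hb, hc, habc, rfl⟩ := r.rails.mem_triangle_planePoint hx
    simp only [mul_one, mul_zero, add_zero] at hx' ⊢
    rcases hx' with hx' | hx'
    · right
      rcases ha.eq_or_lt with rfl | ha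
      · rw [← hβ]
        exact r.eq_vertex_last_of_mem hx'
      · exact absurd hx' (h a b c ha hb hc habc)
    · left
      obtain ⟨a', b', -, -, hab', hx'⟩ := r.rails.mem_segment_planePoint hx'
      simp only [mul_one, hab', Rails.planePoint_eq_iff] at hx'
      obtain rfl : a = 1 := hx'.1
      obtain rfl : b = 0 := by linarith
      obtain rfl : c = 0 := by linarith
      simp

/-- The perpendicular bottom segment of the closure may be tilted. -/
theorem triangleMove_closure {t t' : ℝ}
    (h : ∀ x ∈ r.carrier, r.rails.height (r.rails.point₁ t) < r.rails.height x) (ht : t' < t) :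
    TriangleMove (r.closure t)
      (r.carrier ∪ segment ℝ (r.vertex 0) (r.rails.point₁ t') ∪
        segment ℝ (r.rails.point₁ t') (r.rails.point₂ t) ∪
        segment ℝ (r.rails.point₂ t) (r.vertex r.numSticks)) := by
  obtain ⟨α, hα⟩ := r.exists_vertex_zero_eq
  obtain ⟨β, hβ⟩ := r.exists_vertex_last_eq
  have htα : t < α := by simpa [hα] using r.along_lt_of_below h r.vertex_zero_mem_carrier
  have htβ : t < β := by simpa [hβ] using r.along_lt_of_below h r.vertex_last_mem_carrier
  -- The segment on the first rail is split at height `t`; its lower part is one of the two new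
  -- sides.
  rw [closure, hα, hβ, r.rails.point₁_eq, r.rails.point₁_eq, r.rails.point₂_eq,
    ← r.rails.segment_union_planePoint 1 ht.le htα.le]
  set R := r.rails
  have key := triangleMove_union (Γ := r.carrier ∪ segment ℝ (R.planePoint 1 α)
    (R.planePoint 1 t) ∪ segment ℝ (R.planePoint 0 t) (R.planePoint 0 β))
    (A := R.planePoint 1 t) (B := R.planePoint 0 t) (C := R.planePoint 1 t') ?_ ?_
  · convert key using 1
    · ext; simp only [Set.mem_union]; tauto
    · ext; simp only [Set.mem_union]; tauto
  · apply Rails.affineIndependent_planePoint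
    simp only [sub_self, zero_mul, sub_zero]
    linarith
  · intro x hx hx'
    obtain ⟨a, b, c, ha, hb, hc, habc, rfl⟩ := R.mem_triangle_planePoint hx
    -- The triangle lies at or below height `t`, the arc strictly above it.
    have hle : a * t + b * t + c * t' ≤ t := by
      obtain rfl : a = 1 - b - c := by linarith
      linarith [mul_nonneg hc (sub_nonneg.2 ht.le)]
    rcases hx' with (hx' | hx') | hx'
    · have := r.along_lt_of_below h hx'
      rw [Rails.along_planePoint] at this
      linarith
    · left
      obtain ⟨a', b', ha', hb', hab', hx'⟩ := R.mem_segment_planePoint hx'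
      obtain ⟨h1, h2⟩ := R.planePoint_eq_iff.1 hx'
      rw [R.planePoint_eq_iff]
      obtain rfl : b' = 1 - a' := by linarith
      exact ⟨by linarith, by linarith [mul_nonneg ha' (sub_nonneg.2 htα.le)]⟩
    · right
      obtain ⟨a', b', ha', hb', hab', hx'⟩ := R.mem_segment_planePoint hx'
      obtain ⟨h1, h2⟩ := R.planePoint_eq_iff.1 hx'
      rw [R.planePoint_eq_iff]
      obtain rfl : a' = 1 - b' := by linarith
      exact ⟨by linarith, by linarith [mul_nonneg hb' (sub_nonneg.2 htβ.le)]⟩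

/-- The stick knot obtained by closing an arc up with two sticks that meet on the first rail. -/
noncomputable def closeWithTwoSticks (t : ℝ) (h₁ : r.rails.point₁ t ∉ r.carrier)
    (h₂ : ∀ x ∈ segment ℝ (r.rails.point₁ t) (r.vertex r.numSticks), x ∈ r.carrier →
      x = r.vertex r.numSticks) : StickKnot where
  numSticks := r.numSticks + 2
  vertex i := if i ≤ r.numSticks then r.vertex i else
    if i = r.numSticks + 1 then r.rails.point₁ t else r.vertex 0
  three_le := by have := r.numSticks_pos; omega
  closed := by simp
  nondegenerate i hi := by
    rcases lt_trichotomy i r.numSticks with h | rfl | h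
    · simpa [h.le, Nat.succ_le_of_lt h] using r.nondegenerate i h
    · have : r.vertex r.numSticks ≠ r.rails.point₁ t := fun h =>
        h₁ (h ▸ r.vertex_last_mem_carrier)
      simpa using this
    · obtain rfl : i = r.numSticks + 1 := by omega
      have : r.rails.point₁ t ≠ r.vertex 0 := fun h => h₁ (h ▸ r.vertex_zero_mem_carrier)
      simpa using this
  simple i j hij hj x hxi hxj := by
    obtain ⟨α, hα⟩ := r.exists_vertex_zero_eq
    obtain ⟨β, hβ⟩ := r.exists_vertex_last_eq
    rcases lt_trichotomy j r.numSticks with h | rfl | h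
    · have hi : i < r.numSticks := by omega
      simp only [h.le, hi.le, Nat.succ_le_of_lt h, Nat.succ_le_of_lt hi, if_true] at hxi hxj ⊢
      exact Or.inl (r.simple i j hij h x hxi hxj)
    · simp only [hij.le, Nat.succ_le_of_lt hij, if_true, le_refl] at hxi hxj ⊢
      simp only [Nat.not_succ_le_self, if_false] at hxj
      rw [segment_symm] at hxj
      have hx := h₂ x hxj ⟨i, hij, hxi⟩
      exact Or.inl ⟨(r.eq_of_vertex_last_mem hij (hx ▸ hxi)).symm, hx⟩
    · obtain rfl : j = r.numSticks + 1 := by omega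
      simp only [Nat.not_succ_le_self, if_false, if_true, Nat.zero_le,
        show ¬ r.numSticks + 1 + 1 ≤ r.numSticks by omega,
        show r.numSticks + 1 + 1 ≠ r.numSticks + 1 by omega] at hxi hxj ⊢
      rw [hα, Rails.point₁_eq] at hxj
      obtain ⟨a', b', ha', hb', hab', rfl⟩ := r.rails.mem_segment_planePoint hxj
      simp only [mul_one, hab'] at hxi ⊢
      rcases Nat.lt_or_ge i r.numSticks with hi | hi
      · simp only [hi.le, Nat.succ_le_of_lt hi, if_true] at hxi
        have hx := r.eq_vertex_zero_of_mem ⟨i, hi, hxi⟩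
        exact Or.inr ⟨r.eq_zero_of_vertex_zero_mem hi (hx ▸ hxi), trivial, hx⟩
      · obtain rfl : i = r.numSticks := by omega
        simp only [le_refl, Nat.not_succ_le_self, if_false, if_true] at hxi
        rw [hβ, Rails.point₁_eq] at hxi
        obtain ⟨a, b, ha, hb, hab, hx⟩ := r.rails.mem_segment_planePoint hxi
        left
        refine ⟨rfl, ?_⟩
        obtain ⟨h1, h2⟩ := r.rails.planePoint_eq_iff.1 hx
        obtain rfl : b = 1 := by linarith
        obtain rfl : a = 0 := by linarith
        rw [h2, Rails.point₁_eq]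
        simp

theorem carrier_closeWithTwoSticks (t : ℝ) (h₁ : r.rails.point₁ t ∉ r.carrier)
    (h₂ : ∀ x ∈ segment ℝ (r.rails.point₁ t) (r.vertex r.numSticks), x ∈ r.carrier →
      x = r.vertex r.numSticks) :
    (r.closeWithTwoSticks t h₁ h₂).carrier =
      r.carrier ∪ segment ℝ (r.vertex 0) (r.rails.point₁ t) ∪
        segment ℝ (r.rails.point₁ t) (r.vertex r.numSticks) := by
  ext x
  rw [segment_symm ℝ (r.vertex 0), segment_symm ℝ _ (r.vertex r.numSticks)]
  constructor
  · rintro ⟨i, hi, hx⟩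
    simp only [closeWithTwoSticks] at hi hx
    rcases lt_trichotomy i r.numSticks with h | rfl | h
    · rw [if_pos h.le, if_pos (Nat.succ_le_of_lt h)] at hx
      exact Or.inl (Or.inl ⟨i, h, hx⟩)
    · exact Or.inr (by simpa using hx)
    · obtain rfl : i = r.numSticks + 1 := by omega
      exact Or.inl (Or.inr (by simpa using hx))
  · rintro ((⟨i, hi, hx⟩ | hx) | hx)
    · refine ⟨i, by simp only [closeWithTwoSticks]; omega, ?_⟩
      simpa [closeWithTwoSticks, hi.le, Nat.succ_le_of_lt hi] using hx
    · exact ⟨r.numSticks + 1, by simp [closeWithTwoSticks],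
        by simpa [closeWithTwoSticks] using hx⟩
    · exact ⟨r.numSticks, by simp [closeWithTwoSticks], by simpa [closeWithTwoSticks] using hx⟩

/-- A steep enough stick from the first rail to the head passes below the slope bound `M`, and so
does the whole triangle that it spans with the second rail. -/
theorem exists_stickKnot_equiv_closure {t : ℝ}
    (h : ∀ x ∈ r.carrier, r.rails.height (r.rails.point₁ t) < r.rails.height x) :
    ∃ K : StickKnot, K.numSticks = r.numSticks + 2 ∧ PLEquiv K.carrier (r.closure t) := by
  obtain ⟨α, hα⟩ := r.exists_vertex_zero_eq
  obtain ⟨β, hβ⟩ := r.exists_vertex_last_eq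
  have htβ : t < β := by simpa [hβ] using r.along_lt_of_below h r.vertex_last_mem_carrier
  obtain ⟨M, hM⟩ := r.exists_slope_bound hβ
  -- `t' < t` serves to tilt the bottom segment, `t' < β - M` to keep the slanted stick off the arc.
  obtain ⟨t', ht'⟩ := exists_lt (min t (β - M))
  obtain ⟨ht, htM⟩ := lt_min_iff.1 ht'
  have hsector : ∀ a b c : ℝ, 0 < a → 0 ≤ b → 0 ≤ c → a + b + c = 1 →
      r.rails.planePoint a (a * t' + b * β + c * t) ∉ r.carrier := by
    -- The drop below the head is `a * (β - t') + c * (β - t)`, which exceeds `M * a`.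
    intro a b c ha hb hc habc hx
    have := hM _ _ ha hx
    obtain rfl : b = 1 - a - c := by linarith
    nlinarith
  refine ⟨r.closeWithTwoSticks t' ?_ ?_, rfl, ?_⟩
  · intro hx
    have := r.along_lt_of_below h hx
    rw [Rails.point₁_eq, Rails.along_planePoint] at this
    linarith
  · rw [Rails.point₁_eq, hβ]
    intro x hx hx'
    obtain ⟨a, b, ha, hb, hab, rfl⟩ := r.rails.mem_segment_planePoint hx
    simp only [mul_one, mul_zero, add_zero] at hx' ⊢
    rcases ha.eq_or_lt with rfl | ha
    · rw [← hβ]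
      exact r.eq_vertex_last_of_mem hx'
    · exact absurd (by simpa using hx') (hsector a b 0 ha hb le_rfl (by linarith))
  · rw [carrier_closeWithTwoSticks]
    exact .trans _ _ _ (.rel _ _ (r.triangleMove_of_sector hα hβ htβ hsector))
      (.symm _ _ (.rel _ _ (r.triangleMove_closure h ht)))

/-- The same arc with the rails directed the other way. -/
def flip : StickRailArc where
  rails :=
    { r.rails with
      d := -r.rails.d
      d_ne_zero := neg_ne_zero.2 r.rails.d_ne_zero
      perp := by rw [inner_neg_right, r.rails.perp, neg_zero] }
  numSticks := r.numSticks
  vertex := r.vertex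
  nondegenerate := r.nondegenerate
  simple := r.simple
  tail_mem := by
    obtain ⟨t, ht⟩ := r.tail_mem
    exact ⟨-t, by simpa [Rails.point₁] using ht⟩
  head_mem := by
    obtain ⟨t, ht⟩ := r.head_mem
    exact ⟨-t, by simpa [Rails.point₂] using ht⟩
  interior_disjoint := by
    rintro x hx (⟨t, ht⟩ | ⟨t, ht⟩)
    · exact r.interior_disjoint x hx (Or.inl ⟨-t, by simpa [Rails.point₁] using ht⟩)
    · exact r.interior_disjoint x hx (Or.inr ⟨-t, by simpa [Rails.point₂] using ht⟩)

theorem isUnderCompanion_flip {κ : KnotClass} (h : r.IsOverCompanion κ) :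
    r.flip.IsUnderCompanion κ := by
  obtain ⟨K, hK, t, ht, he⟩ := h
  refine ⟨K, hK, -t, fun x hx => ?_, ?_⟩
  · simpa [flip, Rails.height, Rails.point₁] using ht x hx
  · simpa [flip, closure, carrier, Rails.point₁, Rails.point₂] using he

theorem stickNumber_le_of_isUnderCompanion {κ : KnotClass} (h : r.IsUnderCompanion κ) :
    stickNumber κ ≤ r.numSticks + 2 := by
  obtain ⟨K, rfl, t, ht, he⟩ := h
  obtain ⟨L, hL, hLe⟩ := r.exists_stickKnot_equiv_closure ht
  exact Nat.sInf_le ⟨L, Quotient.sound (.trans _ _ _ hLe (.symm _ _ he)), hL⟩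

theorem stickNumber_le {κ : KnotClass} (h : r.IsUnderCompanion κ ∨ r.IsOverCompanion κ) :
    stickNumber κ ≤ r.numSticks + 2 := by
  rcases h with h | h
  · exact r.stickNumber_le_of_isUnderCompanion h
  · exact r.flip.stickNumber_le_of_isUnderCompanion (r.isUnderCompanion_flip h)

end StickRailArc

/-! ### Upper bound: generic rails through the ends of a stick -/

/-- Each span has dimension at most two, and finitely many proper subspaces of a real vector space
do not cover it. -/
theorem exists_notMem_span_pair (u : Space3) (S : Finset Space3) :
    ∃ e : Space3, ∀ w ∈ S, e ∉ Submodule.span ℝ ({u, w} : Set Space3) := by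
  classical
  have h := Subspace.biUnion_ne_univ_of_top_notMem (k := ℝ) (E := Space3)
    (s := S.image fun w => Submodule.span ℝ ({u, w} : Set Space3)) (by
      intro h
      obtain ⟨w, -, hw⟩ := Finset.mem_image.1 h
      have h2 := finrank_span_finset_le_card (R := ℝ) ({u, w} : Finset Space3)
      rw [Set.finrank, Finset.coe_pair, hw, finrank_top, finrank_euclideanSpace_fin] at h2
      have := Finset.card_le_two (a := u) (b := w)
      omega)
  obtain ⟨e, he⟩ := (Set.ne_univ_iff_exists_notMem _).1 h
  refine ⟨e, fun w hw hmem => he ?_⟩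
  simp only [Set.mem_iUnion]
  exact ⟨_, Finset.mem_image_of_mem _ hw, hmem⟩

/-- In a plane that contains no end point of a stick away from the line `A + ℝ u`, a strip of
width one across a direction close to `u` meets the stick only on that line. -/
theorem eventually_strip_inter_segment {A u e a b : Space3}
    (hue : ∀ c c' : ℝ, c • u + c' • e = 0 → c = 0 ∧ c' = 0)
    (ha : a - A ∈ Submodule.span ℝ ({u, e} : Set Space3) → ∃ c : ℝ, a = A + c • u)
    (hb : b - A ∈ Submodule.span ℝ ({u, e} : Set Space3) → ∃ c : ℝ, b = A + c • u) :
    ∀ᶠ θ : ℝ in nhdsWithin 0 (Set.Ioi 0), ∀ s τ : ℝ, 0 ≤ s → s ≤ 1 →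
      A + s • u + τ • (u + θ • e) ∈ segment ℝ a b → τ = 0 := by
  have hpos : ∀ᶠ θ : ℝ in nhdsWithin 0 (Set.Ioi 0), 0 < θ := self_mem_nhdsWithin
  have hexp : ∀ s τ θ : ℝ, A + s • u + τ • (u + θ • e) = A + (s + τ) • u + (τ * θ) • e := by
    intros; module
  have hinj : ∀ α β α' β' : ℝ, A + α • u + β • e = A + α' • u + β' • e → α = α' ∧ β = β' := by
    intro α β α' β' h
    have : (α - α') • u + (β - β') • e = 0 := by
      rw [← sub_eq_zero] at h
      rw [← h]; module
    obtain ⟨h1, h2⟩ := hue _ _ this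
    exact ⟨sub_eq_zero.1 h1, sub_eq_zero.1 h2⟩
  -- Either the stick has no point of the plane off the line, or it has such a point `(α, β)`; in
  -- the second case the strip misses the stick altogether.
  by_cases hex : ∃ α β : ℝ, β ≠ 0 ∧ A + α • u + β • e ∈ segment ℝ a b
  · obtain ⟨α, β, hβ, hx₀⟩ := hex
    -- If `(α, β)` itself were in the strip, then `α = s + τ` and `β = τ * θ`, so `|β| ≤ (|α| + 1) *
    -- θ`; this threshold for `θ` excludes that.
    have hδ : 0 < |β| / (|α| + 1) := by positivity
    filter_upwards [hpos, Ioo_mem_nhdsGT hδ] with θ hθ hθδ s τ hs0 hs1 hx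
    rw [hexp] at hx
    obtain ⟨k, l, hk, hl, hkl, h1⟩ := hx₀
    obtain ⟨k', l', hk', hl', hkl', h2⟩ := hx
    obtain rfl : k = 1 - l := by linarith
    obtain rfl : k' = 1 - l' := by linarith
    by_cases hll : l = l'
    · subst hll
      obtain ⟨h3, h4⟩ := hinj _ _ _ _ (h1.symm.trans h2)
      exfalso
      have hτ : |τ| ≤ |α| + 1 := by
        rw [abs_le]
        constructor <;> linarith [le_abs_self α, neg_abs_le α]
      have : |β| ≤ (|α| + 1) * θ := by
        rw [h4, abs_mul, abs_of_pos hθ]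
        gcongr
      have h5 := (lt_div_iff₀ (by positivity)).1 hθδ.2
      linarith
    -- Two parameters with values in the plane put both ends of the stick in the plane, hence on the
    -- line by `ha` and `hb`, contradicting `β ≠ 0`.
    · have hll' : l - l' ≠ 0 := sub_ne_zero.2 hll
      have hab : b - a = ((l - l')⁻¹ * (α - (s + τ))) • u + ((l - l')⁻¹ * (β - τ * θ)) • e := by
        have : (l - l') • (b - a) = (α - (s + τ)) • u + (β - τ * θ) • e := by
          have : (l - l') • (b - a) =
            ((1 - l) • a + l • b) - ((1 - l') • a + l' • b) := by module
          rw [this, h1, h2]; module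
        rw [mul_smul, mul_smul, ← smul_add, ← this, smul_smul, inv_mul_cancel₀ hll', one_smul]
      have haA : a - A = α • u + β • e - l • (b - a) := by
        have : a - A = ((1 - l) • a + l • b) - A - l • (b - a) := by module
        rw [this, h1]; module
      have hbaW : b - a ∈ Submodule.span ℝ ({u, e} : Set Space3) :=
        Submodule.mem_span_pair.2 ⟨_, _, hab.symm⟩
      have haW : a - A ∈ Submodule.span ℝ ({u, e} : Set Space3) := by
        rw [haA]
        exact Submodule.sub_mem _ (Submodule.mem_span_pair.2 ⟨_, _, rfl⟩)
          (Submodule.smul_mem _ _ hbaW)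
      have hbW : b - A ∈ Submodule.span ℝ ({u, e} : Set Space3) := by
        have := Submodule.add_mem _ hbaW haW
        rwa [sub_add_sub_cancel] at this
      obtain ⟨c, rfl⟩ := ha haW
      obtain ⟨c', rfl⟩ := hb hbW
      refine absurd (hinj α β ((1 - l) * c + l * c') 0 ?_).2 hβ
      rw [← h1]; module
  · filter_upwards [hpos] with θ hθ s τ hs0 hs1 hx
    by_contra hτ
    exact hex ⟨s + τ, τ * θ, mul_ne_zero hτ hθ.ne', by rwa [← hexp]⟩

namespace StickKnot

variable (K : StickKnot)

theorem vertex_pred_add_one : K.vertex (K.numSticks - 1 + 1) = K.vertex 0 := by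
  rw [Nat.sub_add_cancel (by linarith [K.three_le]), K.closed]

/-- Two rails through the ends of the last stick such that the strip between them meets the knot
only in this stick. -/
theorem exists_rails : ∃ (R : Rails) (β : ℝ), K.vertex 0 = R.planePoint 1 0 ∧
    K.vertex (K.numSticks - 1) = R.planePoint 0 β ∧
    ∀ s t : ℝ, 0 ≤ s → s ≤ 1 → R.planePoint s t ∈ polyline (K.numSticks - 1) K.vertex →
      t = β * (1 - s) := by
  classical
  have hn := K.three_le
  set A := K.vertex 0 with hA
  set u := K.vertex (K.numSticks - 1) - A with hu
  have hu0 : u ≠ 0 := by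
    have := K.nondegenerate (K.numSticks - 1) (by omega)
    rw [K.vertex_pred_add_one] at this
    exact sub_ne_zero.2 this
  obtain ⟨e, he⟩ := exists_notMem_span_pair u
    ((Finset.range K.numSticks).image fun i => K.vertex i - A)
  replace he : ∀ i < K.numSticks, e ∉ Submodule.span ℝ ({u, K.vertex i - A} : Set Space3) :=
    fun i hi => he _ (Finset.mem_image_of_mem _ (Finset.mem_range.2 hi))
  have hue : ∀ c c' : ℝ, c • u + c' • e = 0 → c = 0 ∧ c' = 0 := by
    intro c c' h
    have hc' : c' = 0 := by
      by_contra hc'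
      refine he 0 (by omega) (Submodule.mem_span_pair.2 ⟨-(c'⁻¹ * c), 0, ?_⟩)
      have : c'⁻¹ • (c • u + c' • e) = 0 := by rw [h, smul_zero]
      rw [smul_add, smul_smul, smul_smul, inv_mul_cancel₀ hc', one_smul] at this
      rw [eq_comm, ← sub_eq_zero, ← this]; module
    subst hc'
    simpa [hu0] using h
  have hvert : ∀ i < K.numSticks, K.vertex i - A ∈ Submodule.span ℝ ({u, e} : Set Space3) →
      ∃ c : ℝ, K.vertex i = A + c • u := by
    intro i hi h
    obtain ⟨α, β, h⟩ := Submodule.mem_span_pair.1 h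
    by_cases hβ : β = 0
    · refine ⟨α, ?_⟩
      rw [hβ, zero_smul, add_zero] at h
      rw [h]; module
    -- Solving for `e` would put it in the span of `u` and this vertex difference, which its choice
    -- forbids.
    · refine absurd (Submodule.mem_span_pair.2 ⟨-(β⁻¹ * α), β⁻¹, ?_⟩) (he i hi)
      rw [← h, smul_add, smul_smul, smul_smul, inv_mul_cancel₀ hβ]
      module
  have hev : ∀ᶠ θ : ℝ in nhdsWithin 0 (Set.Ioi 0), ∀ i ∈ Finset.range (K.numSticks - 1),
      ∀ s τ : ℝ, 0 ≤ s → s ≤ 1 → A + s • u + τ • (u + θ • e) ∈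
        segment ℝ (K.vertex i) (K.vertex (i + 1)) → τ = 0 := by
    rw [Filter.eventually_all_finset]
    intro i hi
    rw [Finset.mem_range] at hi
    exact eventually_strip_inter_segment hue (hvert i (by omega)) (hvert (i + 1) (by omega))
  obtain ⟨θ, hθ, hθpos⟩ := (hev.and self_mem_nhdsWithin).exists
  replace hθpos : 0 < θ := hθpos
  set d := u + θ • e with hd
  have hd0 : d ≠ 0 := fun h => one_ne_zero (hue 1 θ (by rw [one_smul, ← hd, h])).1
  have hdd : ⟪d, d⟫_ℝ ≠ 0 := (real_inner_self_pos.2 hd0).ne'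
  -- The other end of the stick is `A + u`. Sliding it by `-c • d` brings it to the height of `A`,
  -- so `c` is the head's parameter on the second rail.
  set c := ⟪u, d⟫_ℝ / ⟪d, d⟫_ℝ with hc
  let R : Rails :=
    { p := A
      q := A + (u - c • d)
      d := d
      d_ne_zero := hd0
      p_ne_q := by
        intro h
        have h0 : u - c • d = 0 := by simpa using h.symm
        have h1 := hue (1 - c) (-(c * θ)) (by rw [← h0, hd]; module)
        rcases mul_eq_zero.1 (neg_eq_zero.1 h1.2) with h2 | h2
        · linarith [h1.1]
        · exact hθpos.ne' h2
      perp := by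
        rw [add_sub_cancel_left, inner_sub_left, inner_smul_left, hc]
        simp only [conj_trivial]
        field_simp
        ring }
  have hplane : ∀ s t : ℝ, R.planePoint s t = A + (1 - s) • u + (t - c * (1 - s)) • d := by
    intro s t
    simp only [Rails.planePoint, R]
    module
  refine ⟨R, c, ?_, ?_, ?_⟩
  · rw [hplane]; module
  · rw [hplane, hu]; module
  · rintro s t hs0 hs1 ⟨i, hi, hx⟩
    rw [hplane] at hx
    -- The first coordinate is `1 - s` because `A` lies on the rail `s = 1`; then `τ = 0` reads `t =
    -- c * (1 - s)`.
    have := hθ i (Finset.mem_range.2 hi) (1 - s) _ (by linarith) (by linarith) hx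
    linarith

theorem carrier_eq : K.carrier = polyline (K.numSticks - 1) K.vertex ∪
    segment ℝ (K.vertex 0) (K.vertex (K.numSticks - 1)) := by
  have hn := K.three_le
  ext x
  rw [segment_symm]
  constructor
  · rintro ⟨i, hi, hx⟩
    rcases Nat.lt_or_ge i (K.numSticks - 1) with h | h
    · exact Or.inl ⟨i, h, hx⟩
    · obtain rfl : i = K.numSticks - 1 := by omega
      rw [K.vertex_pred_add_one] at hx
      exact Or.inr hx
  · rintro (⟨i, hi, hx⟩ | hx)
    · exact ⟨i, by omega, hx⟩
    · refine ⟨K.numSticks - 1, by omega, ?_⟩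
      rwa [K.vertex_pred_add_one]

theorem eq_or_eq_of_mem_last_stick {x : Space3}
    (hx : x ∈ segment ℝ (K.vertex 0) (K.vertex (K.numSticks - 1)))
    (hx' : x ∈ polyline (K.numSticks - 1) K.vertex) :
    x = K.vertex 0 ∨ x = K.vertex (K.numSticks - 1) := by
  have hn := K.three_le
  obtain ⟨i, hi, hx'⟩ := hx'
  rw [segment_symm] at hx
  rcases K.simple i (K.numSticks - 1) hi (by omega) x hx' (by rwa [K.vertex_pred_add_one]) with
    h | h
  · exact Or.inr h.2
  · exact Or.inl h.2.2

/-- The last stick is opened to the corner `R.point₁ t` on the first rail, with `t` below the arc,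
and then pushed to the perpendicular closing path. Both triangles lie in the strip of
`exists_rails`. -/
theorem exists_stickRailArc : ∃ r : StickRailArc, r.IsUnderCompanion K.knotClass ∧
    r.numSticks = K.numSticks - 1 := by
  have hn := K.three_le
  obtain ⟨R, β, hA, hB, hR⟩ := K.exists_rails
  let r : StickRailArc :=
    { rails := R
      numSticks := K.numSticks - 1
      vertex := K.vertex
      nondegenerate := fun i hi => K.nondegenerate i (by omega)
      simple := fun i j hij hj x hxi hxj => by
        rcases K.simple i j hij (by omega) x hxi hxj with h | h
        · exact h
        · omega
      tail_mem := ⟨0, by rw [R.point₁_eq, hA]⟩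
      head_mem := ⟨β, by rw [R.point₂_eq, hB]⟩
      interior_disjoint := by
        rintro x hx (⟨t, rfl⟩ | ⟨t, rfl⟩)
        · left
          rw [R.point₁_eq] at hx ⊢
          have := hR 1 t zero_le_one le_rfl hx
          rw [hA, this]; simp
        · right
          rw [R.point₂_eq] at hx ⊢
          have := hR 0 t le_rfl zero_le_one hx
          rw [hB, this]; simp }
  refine ⟨r, ⟨K, rfl, ?_⟩, rfl⟩
  obtain ⟨t₀, ht₀⟩ := ((isCompact_polyline (K.numSticks - 1) K.vertex).image
    R.continuous_along).bddBelow
  obtain ⟨t, ht⟩ := exists_lt t₀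
  have hbelow : ∀ x ∈ r.carrier, r.rails.height (r.rails.point₁ t) < r.rails.height x := by
    intro x hx
    rw [Rails.height_lt_iff, Rails.point₁_eq, Rails.along_planePoint]
    exact ht.trans_le (ht₀ ⟨x, hx, rfl⟩)
  have ht0 : t < 0 := by
    simpa [r, hA] using r.along_lt_of_below hbelow r.vertex_zero_mem_carrier
  have htβ : t < β := by
    simpa [r, hB] using r.along_lt_of_below hbelow r.vertex_last_mem_carrier
  refine ⟨t, hbelow, .trans _ _ _ (.rel _ _ ?_)
    (.rel _ _ (r.triangleMove_of_sector (t := t) (t' := t) hA hB htβ ?_))⟩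
  · rw [segment_symm ℝ (r.rails.point₁ t)]
    have key := triangleMove_union (Γ := r.carrier) (A := K.vertex 0)
      (B := K.vertex (K.numSticks - 1)) (C := R.point₁ t) ?_ ?_
    · rw [K.carrier_eq]
      rw [segment_symm ℝ (R.point₁ t)] at key
      exact key
    · rw [hA, hB, R.point₁_eq]
      apply R.affineIndependent_planePoint
      simpa using ht0.ne
    · intro x hx hx'
      refine K.eq_or_eq_of_mem_last_stick ?_ hx'
      rw [hA, hB, R.point₁_eq] at hx
      obtain ⟨a, b, c, ha, hb, hc, habc, rfl⟩ := R.mem_triangle_planePoint hx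
      -- On the arc the along coordinate is `b * β`, but here it is `b * β + c * t`. So `c = 0` and
      -- the point lies on the removed stick.
      have h := hR _ _ (by linarith) (by linarith) hx'
      have hc0 : c * t = 0 := by
        obtain rfl : a = 1 - b - c := by linarith
        linear_combination h
      obtain rfl := (mul_eq_zero.1 hc0).resolve_right ht0.ne
      rw [hA, hB]
      exact ⟨a, b, ha, hb, by linarith, by rw [R.planePoint_combo (by linarith)]; simp⟩
  · intro a b c ha hb hc habc hx
    -- This forces `a * t = c * (β - t)`, with left side negative and right side nonnegative.
    have h := hR _ _ ha.le (by linarith) hx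
    obtain rfl : b = 1 - a - c := by linarith
    linarith [mul_pos_of_neg_of_neg ht0 (neg_lt_zero.2 ha),
      mul_nonneg hc (sub_nonneg.2 htβ.le)]

end StickKnot

/-! ### The two bounds combined -/

theorem mainTheorem7 (κ : KnotClass) :
    (stickNumber κ : ℤ) - 2 ≤ (railStickNumber κ : ℤ) ∧
      (railStickNumber κ : ℤ) ≤ (stickNumber κ : ℤ) - 1 := by
  have hne : {n | ∃ K : StickKnot, K.knotClass = κ ∧ K.numSticks = n}.Nonempty := by
    obtain ⟨K, hK⟩ := Quotient.exists_rep κ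
    exact ⟨_, K, hK, rfl⟩
  obtain ⟨K, rfl, hKn⟩ := Nat.sInf_mem hne
  replace hKn : K.numSticks = stickNumber K.knotClass := hKn
  obtain ⟨r₀, hr₀, hn₀⟩ := K.exists_stickRailArc
  have hmem : r₀.numSticks ∈ {n | ∃ r : StickRailArc, (r.IsUnderCompanion K.knotClass ∨
      r.IsOverCompanion K.knotClass) ∧ r.numSticks = n} := ⟨r₀, Or.inl hr₀, rfl⟩
  have hupper : railStickNumber K.knotClass ≤ r₀.numSticks := Nat.sInf_le hmem
  -- The arc `r₀` also shows that the infimum is attained, rather than being the default 0 of the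
  -- empty set.
  obtain ⟨r, hr, hrn⟩ := Nat.sInf_mem ⟨_, hmem⟩
  replace hrn : r.numSticks = railStickNumber K.knotClass := hrn
  have hlower := r.stickNumber_le hr
  -- This makes the natural subtraction in `K.numSticks - 1` an honest one.
  have := K.three_le
  omega
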